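/- **Theorem 3 (Achievability for Error Metric 2, linear regime).** Setting: let $\beta>2$, $\alpha\in(0,1)$, $\nu>0$, and for each $M$ put $L=L^{(M)}=\lfloor \frac1\beta M\rfloor$. For ${\bf x}\in\mathbb C^M$ let $\mathrm{supp}({\bf x})=\{i: x_i\ne 0\}$, $\mu({\bf x})=\min_{i\in\mathrm{supp}({\bf x})}|x_i|$ and $\|{\bf x}\|_2^2=\sum_i|x_i|^2$ (the total power). One observes ${\bf y}={\bf A}{\bf x}+{\bf n}\in\mathbb C^N$, where the $N\times M$ matrix ${\bf A}$ has i.i.d. circularly-symmetric complex Gaussian entries $\mathcal N_C(0,1)$ and ${\bf n}\sim\mathcal N_C(0,\nu^2I_N)$ is independent of ${\bf A}$. For $\delta>0$, an index set $\mathcal J\subset\{1,\dots,M\}$ with $|\mathcal J|=L$ is called $\delta$-jointly typical with ${\bf y}$ if the matrix ${\bf A}_{\mathcal J}$ of the columns of ${\bf A}$ with index in $\mathcal J$ has rank $L$ and $$\Big|\tfrac1N\|\Pi^{\perp}_{{\bf A}_{\mathcal J}}{\bf y}\|_2^2-\tfrac{N-L}{N}\nu^2\Big|<\delta,\qquad \Pi^\perp_{\bf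 B}=I-{\bf B}({\bf B}^*{\bf B})^{-1}{\bf B}^*.$$ A joint-typicality decoder with threshold $\delta$ is a measurable map $({\bf A},{\bf y})\mapsto\mathcal D({\bf y})\subset\{1,\dots,M\}$ which outputs a $\delta$-jointly typical set whenever there is one. An error (Error Metric 2) occurs unless $|\mathcal D({\bf y})\cap\mathrm{supp}({\bf x})|/|\mathrm{supp}({\bf x})|>1-\alpha$; $p_{\rm err}({\bf A}|{\bf x})$ denotes the probability of error over ${\bf n}$ for given ${\bf A}$, and $p_{\rm err}(\mathcal D|{\bf x})=\mathbb E_{\bf A}\,p_{\rm err}({\bf A}|{\bf x})$. Claim: for every $c>0$ there are constants $C_3>1$, $\delta>0$ and $r>0$, depending only on $\alpha$, $\beta$, $\nu$ and $c$, such that the following holds. Let $N=N(M)$ be natural numbers with $N(M)>C_3L^{(M)}$ for all sufficiently large $M$. Then joint-typicality decoders with threshold $\delta$ exist for all $M$. Moreover, for every choice of such decoders, every $P$ and every sequence ${\bf x}^{(M)}\in\mathbb C^M$ with $|\mathrm{supp}({\bf x}^{(M)})|=L^{(M)}$ for all $M$ and with $L^{(M)}\mu^2({\bf x}^{(M)})=c$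 and $\|{\bf x}^{(M)}\|_2^2=P$ for all sufficiently large $M$: 1. $p_{\rm err}(\mathcal D|{\bf x}^{(M)})\to0$ as $M\to\infty$; 2. in fact $p_{\rm err}(\mathcal D|{\bf x}^{(M)})\le e^{-rM}$ for all sufficiently large $M$; 3. for every $\xi\in(0,1]$, $\mathbb P\big(p_{\rm err}({\bf A}|{\bf x}^{(M)})>\xi\big)\le e^{-rM}$ for all sufficiently large $M$. -/

import Mathlib

open MeasureTheory ProbabilityTheory Filter Topology
open scoped ENNReal NNReal Matrix

namespace NoisyCS

noncomputable section

/-- The number of nonzero coefficients, `L = ⌊M / β⌋`. -/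
def sparsity (β : ℝ) (M : ℕ) : ℕ := ⌊(1 / β) * (M : ℝ)⌋₊

/-- The support of a complex vector. -/
def supp {M : ℕ} (x : Fin M → ℂ) : Finset (Fin M) := Finset.univ.filter fun i => x i ≠ 0

/-- The smallest modulus of an entry of `x` on its support. -/
def minMod {M : ℕ} (x : Fin M → ℂ) : ℝ := ⨅ i : supp x, ‖x i‖

/-- The total power (squared Euclidean norm) of a vector. -/
def power {M : ℕ} (x : Fin M → ℂ) : ℝ := ∑ i, ‖x i‖ ^ 2

/-- The circularly-symmetric complex Gaussian law with mean zero and variance `v`: real and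
imaginary part are independent real Gaussians with variance `v / 2`. -/
def complexGaussian (v : ℝ≥0) : Measure ℂ :=
  ((gaussianReal 0 (v / 2)).prod (gaussianReal 0 (v / 2))).map
    fun p : ℝ × ℝ => (p.1 : ℂ) + (p.2 : ℂ) * Complex.I

/-- The law of an `N × M` matrix with i.i.d. complex Gaussian entries of variance one. -/
def matrixLaw (N M : ℕ) : Measure (Fin N → Fin M → ℂ) :=
  Measure.pi fun _ => Measure.pi fun _ => complexGaussian 1

/-- The law of the noise vector, with i.i.d. complex Gaussian entries of variance `ν ^ 2`. -/
def noiseLaw (N : ℕ) (ν : ℝ) : Measure (Fin N → ℂ) :=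
  Measure.pi fun _ => complexGaussian (Real.toNNReal (ν ^ 2))

/-- The matrix formed by the columns of `A` with index in `J`. -/
def columns {N M : ℕ} (A : Fin N → Fin M → ℂ) (J : Finset (Fin M)) : Matrix (Fin N) J ℂ :=
  Matrix.of fun i j => A i j

/-- The matrix `I - B (B* B)⁻¹ B*`, which for `B` of full column rank is the orthogonal projection
onto the orthogonal complement of the column space of `B`. -/
def perpProj {N : ℕ} {κ : Type} [Fintype κ] [DecidableEq κ] (B : Matrix (Fin N) κ ℂ) :
    Matrix (Fin N) (Fin N) ℂ :=
  1 - B * (Bᴴ * B)⁻¹ * Bᴴ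

/-- The observation `y` and the index set `J` of size `L` are `δ`-jointly typical with respect to
the measurement matrix `A` and the noise level `ν`. -/
def JointlyTypical {N M : ℕ} (L : ℕ) (ν δ : ℝ) (A : Fin N → Fin M → ℂ) (y : Fin N → ℂ)
    (J : Finset (Fin M)) : Prop :=
  J.card = L ∧ (columns A J).rank = L ∧
    |1 / (N : ℝ) * power (perpProj (columns A J) *ᵥ y) - ((N : ℝ) - L) / N * ν ^ 2| < δ

/-- A decoder sees the measurement matrix and the observation and outputs a set of indices. -/
abbrev Decoder (N M : ℕ) : Type := (Fin N → Fin M → ℂ) → (Fin N → ℂ) → Finset (Fin M)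

/-- `D` is a (measurable) joint-typicality decoder with threshold `δ`: whenever some index set of
size `L` is `δ`-jointly typical with the observation, the output of `D` is such a set. -/
structure IsJointTypicalityDecoder {N M : ℕ} (L : ℕ) (ν δ : ℝ) (D : Decoder N M) : Prop where
  measurable : ∀ J : Finset (Fin M),
    MeasurableSet {p : (Fin N → Fin M → ℂ) × (Fin N → ℂ) | D p.1 p.2 = J}
  typical : ∀ A y, (∃ J, JointlyTypical L ν δ A y J) → JointlyTypical L ν δ A y (D A y)

/-- Success for the second error metric: the estimated support `J` contains more than a fraction
`1 - α` of the support of `x`. -/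
def Recovers {M : ℕ} (α : ℝ) (x : Fin M → ℂ) (J : Finset (Fin M)) : Prop :=
  ((J ∩ supp x).card : ℝ) / ((supp x).card : ℝ) > 1 - α

/-- The error probability `p_err(A | x)` over the noise for a fixed measurement matrix. -/
def errProb {N M : ℕ} (α ν : ℝ) (D : Decoder N M) (x : Fin M → ℂ) (A : Fin N → Fin M → ℂ) : ℝ≥0∞ :=
  noiseLaw N ν {n | ¬ Recovers α x (D A (Matrix.of A *ᵥ x + n))}

/-- The error probability `p_err(D | x)`, averaged over Gaussian measurement matrices. -/
def avgErrProb {N M : ℕ} (α ν : ℝ) (D : Decoder N M) (x : Fin M → ℂ) : ℝ≥0∞ :=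
  ∫⁻ A, errProb α ν D x A ∂(matrixLaw N M)

open scoped ComplexOrder in
lemma measurableSet_jointlyTypical {N M : ℕ} (L : ℕ) (ν δ : ℝ) (J : Finset (Fin M)) :
    MeasurableSet {p : (Fin N → Fin M → ℂ) × (Fin N → ℂ) | JointlyTypical L ν δ p.1 p.2 J} := by
  have hC : Continuous fun p : (Fin N → Fin M → ℂ) × (Fin N → ℂ) => columns p.1 J :=
    continuous_pi fun i => continuous_pi fun j => by
      change Continuous fun p : (Fin N → Fin M → ℂ) × (Fin N → ℂ) => p.1 i j
      fun_prop
  have hG : Continuous fun p : (Fin N → Fin M → ℂ) × (Fin N → ℂ) =>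
      (columns p.1 J)ᴴ * columns p.1 J := hC.matrix_conjTranspose.matrix_mul hC
  by_cases hJ : J.card = L
  swap
  · simp [JointlyTypical, hJ]
  have hr : MeasurableSet {p : (Fin N → Fin M → ℂ) × (Fin N → ℂ) | (columns p.1 J).rank = L} := by
    have : {p : (Fin N → Fin M → ℂ) × (Fin N → ℂ) | (columns p.1 J).rank = L} =
        {p | ((columns p.1 J)ᴴ * columns p.1 J).det = 0}ᶜ := by
      ext p
      simp only [Set.mem_ofPred_eq, Set.mem_compl_iff]
      rw [← Matrix.rank_conjTranspose_mul_self, ← ne_eq, ← isUnit_iff_ne_zero,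
        ← Matrix.isUnit_iff_isUnit_det]
      constructor
      · intro h
        rw [← Matrix.linearIndependent_cols_iff_isUnit, linearIndependent_iff_card_eq_finrank_span,
          Set.finrank, ← Matrix.rank_eq_finrank_span_cols, h]
        simp [hJ]
      · intro h
        rw [Matrix.rank_of_isUnit _ h]
        simp [hJ]
    rw [this]
    exact (isClosed_eq hG.matrix_det continuous_const).measurableSet.compl
  have hm : Measurable fun p : (Fin N → Fin M → ℂ) × (Fin N → ℂ) =>
      power (perpProj (columns p.1 J) *ᵥ p.2) := by
    have hinv : ∀ a b, Measurable fun p : (Fin N → Fin M → ℂ) × (Fin N → ℂ) =>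
        (((columns p.1 J)ᴴ * columns p.1 J)⁻¹) a b := by
      intro a b
      simp only [Matrix.inv_def, Matrix.smul_apply, smul_eq_mul, Ring.inverse_eq_inv']
      exact hG.matrix_det.measurable.inv.mul (hG.matrix_adjugate.matrix_elem a b).measurable
    have hC' : ∀ i j, Measurable fun p : (Fin N → Fin M → ℂ) × (Fin N → ℂ) =>
        columns p.1 J i j := fun i j => (hC.matrix_elem i j).measurable
    have hCs : ∀ i j, Measurable fun p : (Fin N → Fin M → ℂ) × (Fin N → ℂ) =>
        (columns p.1 J)ᴴ i j := fun i j => (hC.matrix_conjTranspose.matrix_elem i j).measurable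
    have hy : ∀ i, Measurable fun p : (Fin N → Fin M → ℂ) × (Fin N → ℂ) => p.2 i :=
      fun i => by fun_prop
    have hP : ∀ i k, Measurable fun p : (Fin N → Fin M → ℂ) × (Fin N → ℂ) =>
        perpProj (columns p.1 J) i k := by
      intro i k
      simp only [perpProj, Matrix.sub_apply, Matrix.mul_apply]
      refine measurable_const.sub (Finset.measurable_sum _ fun j _ => Measurable.mul ?_ (hCs j k))
      exact Finset.measurable_sum _ fun l _ => (hC' i l).mul (hinv l j)
    simp only [power, Matrix.mulVec, dotProduct]
    exact Finset.measurable_sum _ fun i _ =>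
      ((Finset.measurable_sum _ fun k _ => (hP i k).mul (hy k)).norm.pow_const 2)
  have hlt : MeasurableSet {p : (Fin N → Fin M → ℂ) × (Fin N → ℂ) |
      |1 / (N : ℝ) * power (perpProj (columns p.1 J) *ᵥ p.2) - ((N : ℝ) - L) / N * ν ^ 2| < δ} :=
    measurableSet_lt (measurable_norm.comp ((hm.const_mul _).sub_const _)) measurable_const
  have : {p : (Fin N → Fin M → ℂ) × (Fin N → ℂ) | JointlyTypical L ν δ p.1 p.2 J} =
      {p | (columns p.1 J).rank = L} ∩ {p |
      |1 / (N : ℝ) * power (perpProj (columns p.1 J) *ᵥ p.2) - ((N : ℝ) - L) / N * ν ^ 2| < δ} := by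
    ext p
    simp [JointlyTypical, hJ]
  rw [this]
  exact hr.inter hlt

/-- Joint-typicality decoders exist, for all parameters. -/
lemma exists_isJointTypicalityDecoder (N M L : ℕ) (ν δ : ℝ) :
    ∃ D : Decoder N M, IsJointTypicalityDecoder L ν δ D := by
  classical
  let F : (Finset (Fin M) → Prop) → Finset (Fin M) := fun T =>
    if h : ∃ J, T J then h.choose else ∅
  refine ⟨fun A y => F (JointlyTypical L ν δ A y), ⟨fun J => ?_, fun A y h => ?_⟩⟩
  · have hT : Measurable fun p : (Fin N → Fin M → ℂ) × (Fin N → ℂ) =>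
        (JointlyTypical L ν δ p.1 p.2) :=
      measurable_pi_iff.2 fun K => measurableSet_setOfPred.1 (measurableSet_jointlyTypical L ν δ K)
    exact hT (Set.toFinite (F ⁻¹' {J})).measurableSet
  · simp only [F, dif_pos h]
    exact h.choose_spec

end

end NoisyCS

/-!
Projecting the observation onto the orthogonal complement of the columns of `A` in `J` kills the
part of the signal supported in `J`; the remaining columns are independent of the projection, so the
residual is a complex Gaussian vector of length `N - |J|` whose variance is `ν ^ 2` plus the signal
power missed by `J`. A set that does not recover the support misses power at least `α * c`, so for
it to be typical, as for the support itself not to be, the power of the residual must deviate from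
its mean by a constant factor. Chernoff's bound makes this exponentially unlikely in `N - L`, which
for `C₃` large exceeds any given multiple of `M` and so beats the union bound over at most `2 ^ M`
index sets. Markov's inequality passes from the average over `A` to most matrices `A`.
-/

namespace NoisyCS

/-! ### Complex Gaussian vectors -/

/-- The law of a vector with i.i.d. complex Gaussian entries of variance `v`, indexed by any finite
type; measurement rows, noise and observations all have this law. -/
noncomputable abbrev complexGaussianVector (κ : Type*) [Fintype κ] (v : ℝ≥0) : Measure (κ → ℂ) :=
  Measure.pi fun _ => complexGaussian v

instance isProbabilityMeasure_complexGaussian (v : ℝ≥0) :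
    IsProbabilityMeasure (complexGaussian v) :=
  Measure.isProbabilityMeasure_map (by fun_prop)

instance isProbabilityMeasure_matrixLaw (N M : ℕ) : IsProbabilityMeasure (matrixLaw N M) := by
  unfold matrixLaw; infer_instance

instance isProbabilityMeasure_noiseLaw (N : ℕ) (ν : ℝ) : IsProbabilityMeasure (noiseLaw N ν) := by
  unfold noiseLaw; infer_instance

lemma complexGaussian_eq_map_equivRealProdCLM (v : ℝ≥0) :
    complexGaussian v = ((gaussianReal 0 (v / 2)).prod (gaussianReal 0 (v / 2))).map
      (Complex.equivRealProdCLM.symm : ℝ × ℝ →L[ℝ] ℂ) := by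
  rw [complexGaussian]
  congr 1 with p
  exact (Complex.equivRealProd_symm_apply p).symm

lemma ae_ne_zero_complexGaussian {v : ℝ≥0} (hv : v ≠ 0) :
    ∀ᵐ z ∂complexGaussian v, z ≠ 0 := by
  have hv2 : v / 2 ≠ 0 := by simpa using hv
  have := nullSingletonClass_gaussianReal (μ := 0) hv2
  have hre : ∀ᵐ p ∂(gaussianReal 0 (v / 2)).prod (gaussianReal 0 (v / 2)), p.1 ≠ 0 :=
    Measure.quasiMeasurePreserving_fst.ae (Measure.ae_ne _ 0)
  rw [complexGaussian]
  refine (ae_map_iff (by fun_prop) (measurableSet_singleton (0 : ℂ)).compl).2 ?_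
  filter_upwards [hre] with p hp h
  exact hp (by simpa using congrArg Complex.re h)

lemma charFunDual_gaussianReal_zero (v : ℝ≥0) (ℓ : StrongDual ℝ ℝ) :
    charFunDual (gaussianReal 0 v) ℓ = Complex.exp (-(v * (ℓ 1 : ℂ) ^ 2 / 2)) := by
  rw [charFunDual_eq_charFun_map_one, gaussianReal_map_continuousLinearMap, charFun_gaussianReal]
  simp [sq_nonneg, mul_comm]

lemma charFunDual_complexGaussian (v : ℝ≥0) (ℓ : StrongDual ℝ ℂ) :
    charFunDual (complexGaussian v) ℓ =
      Complex.exp (-(v / 4 * ((ℓ 1 : ℂ) ^ 2 + (ℓ Complex.I : ℂ) ^ 2))) := by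
  rw [complexGaussian_eq_map_equivRealProdCLM, charFunDual_map, charFunDual_prod,
    charFunDual_gaussianReal_zero, charFunDual_gaussianReal_zero, ← Complex.exp_add]
  have hre : Complex.equivRealProdCLM.symm ((1 : ℝ), (0 : ℝ)) = 1 := by
    simp [Complex.equivRealProdCLM_symm_apply]
  have him : Complex.equivRealProdCLM.symm ((0 : ℝ), (1 : ℝ)) = Complex.I := by
    simp [Complex.equivRealProdCLM_symm_apply]
  simp only [ContinuousLinearMap.comp_apply, ContinuousLinearMap.inl_apply,
    ContinuousLinearMap.inr_apply, ContinuousLinearEquiv.coe_coe, hre, him]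
  push_cast
  ring_nf

section

variable {κ ι : Type*} [Fintype κ] [Fintype ι]

lemma exists_strongDual_eq_re_dotProduct (ℓ : StrongDual ℝ (κ → ℂ)) :
    ∃ t : κ → ℂ, ∀ w, ℓ w = (t ⬝ᵥ w).re := by
  classical
  refine ⟨fun k => ⟨ℓ (Pi.single k 1), -ℓ (Pi.single k Complex.I)⟩, fun w => ?_⟩
  have hw : w = ∑ k, ((w k).re • (Pi.single k (1 : ℂ) : κ → ℂ) +
      (w k).im • (Pi.single k Complex.I : κ → ℂ)) := by
    ext k
    simp [Finset.sum_apply, Pi.single_apply, Finset.sum_add_distrib, Complex.re_add_im]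
  conv_lhs => rw [hw]
  simp [dotProduct, Complex.mul_re, mul_comm]

lemma charFunDual_complexGaussianVector (v : ℝ≥0) {ℓ : StrongDual ℝ (κ → ℂ)} {t : κ → ℂ}
    (h : ∀ w, ℓ w = (t ⬝ᵥ w).re) :
    charFunDual (complexGaussianVector κ v) ℓ = Complex.exp (-(v / 4 * (t ⬝ᵥ star t))) := by
  classical
  have hk (k : κ) (z : ℂ) : (ℓ.comp (.single ℝ (fun _ => ℂ) k)) z = (t k * z).re := by simp [h]
  have hsq (k : κ) : ((t k).re : ℂ) ^ 2 + (((t k * Complex.I).re : ℝ) : ℂ) ^ 2 =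
      t k * star (t k) := by
    rw [Complex.star_def, Complex.mul_conj, Complex.normSq_apply]
    simp
    ring
  simp only [charFunDual_pi, charFunDual_complexGaussian, hk, mul_one, hsq]
  rw [← Complex.exp_sum, Finset.sum_neg_distrib, ← Finset.mul_sum]
  rfl

lemma map_mulVec_complexGaussianVector [DecidableEq κ] (T : Matrix κ ι ℂ) (u v : ℝ≥0)
    (hT : T * Tᴴ = ((u : ℝ) : ℂ) • (1 : Matrix κ κ ℂ)) :
    (complexGaussianVector ι v).map (T *ᵥ ·) = complexGaussianVector κ (u * v) := by
  let Λ : (ι → ℂ) →L[ℝ] (κ → ℂ) := (T.mulVecLin.restrictScalars ℝ).toContinuousLinearMap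
  have : IsProbabilityMeasure ((complexGaussianVector ι v).map Λ) :=
    Measure.isProbabilityMeasure_map (by fun_prop)
  change (complexGaussianVector ι v).map Λ = _
  refine Measure.ext_of_charFunDual (funext fun ℓ => ?_)
  obtain ⟨t, ht⟩ := exists_strongDual_eq_re_dotProduct ℓ
  have htT (w : ι → ℂ) : (ℓ.comp Λ) w = (t ᵥ* T ⬝ᵥ w).re := by
    rw [← Matrix.dotProduct_mulVec]
    exact ht _
  have hnorm : t ᵥ* T ⬝ᵥ star (t ᵥ* T) = ((u : ℝ) : ℂ) * (t ⬝ᵥ star t) := by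
    rw [Matrix.star_vecMul, ← Matrix.dotProduct_mulVec, Matrix.mulVec_mulVec, hT,
      Matrix.smul_mulVec, Matrix.one_mulVec, dotProduct_smul, smul_eq_mul]
  rw [charFunDual_map, charFunDual_complexGaussianVector _ ht,
    charFunDual_complexGaussianVector _ htT, hnorm]
  push_cast
  ring_nf

lemma complexGaussianVector_conv (u v : ℝ≥0) :
    complexGaussianVector κ u ∗ complexGaussianVector κ v = complexGaussianVector κ (u + v) := by
  refine Measure.ext_of_charFunDual (funext fun ℓ => ?_)
  obtain ⟨t, ht⟩ := exists_strongDual_eq_re_dotProduct ℓ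
  simp only [charFunDual_conv, charFunDual_complexGaussianVector _ ht, ← Complex.exp_add]
  push_cast
  ring_nf

lemma complexGaussianVector_zero : complexGaussianVector κ 0 = Measure.dirac 0 := by
  refine Measure.ext_of_charFunDual (funext fun ℓ => ?_)
  obtain ⟨t, ht⟩ := exists_strongDual_eq_re_dotProduct ℓ
  simp [charFunDual_complexGaussianVector _ ht, charFunDual_dirac]

end

variable {N M : ℕ}

lemma power_nonneg (x : Fin M → ℂ) : 0 ≤ power x :=
  Finset.sum_nonneg fun _ _ => sq_nonneg _

lemma ofReal_power (x : Fin M → ℂ) : (power x : ℂ) = x ⬝ᵥ star x := by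
  simp [power, dotProduct, Complex.mul_conj']

@[fun_prop]
lemma measurable_power : Measurable (power : (Fin M → ℂ) → ℝ) := by
  unfold power
  fun_prop

lemma map_dotProduct_complexGaussianVector (x : Fin M → ℂ) :
    (complexGaussianVector (Fin M) 1).map (fun a => a ⬝ᵥ x) =
      complexGaussian (power x).toNNReal := by
  have hrow : Matrix.of (fun (_ : Unit) => x) * (Matrix.of fun (_ : Unit) => x)ᴴ =
      (((power x).toNNReal : ℝ) : ℂ) • (1 : Matrix Unit Unit ℂ) := by
    ext
    simp [Matrix.mul_apply, Real.coe_toNNReal _ (power_nonneg x), ofReal_power, dotProduct]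
  have h := congrArg (Measure.map (Function.eval ()))
    (map_mulVec_complexGaussianVector _ _ 1 hrow)
  rw [Measure.map_map (by fun_prop) (by fun_prop),
    (measurePreserving_eval (fun _ : Unit => complexGaussian _) ()).map_eq, mul_one] at h
  rw [← h]
  congr 1 with a
  simp [Matrix.mulVec, dotProduct_comm]

lemma measurable_mulVec (x : Fin M → ℂ) :
    Measurable fun A : Fin N → Fin M → ℂ => Matrix.of A *ᵥ x := by
  unfold Matrix.mulVec dotProduct
  simp only [Matrix.of_apply]
  fun_prop

lemma map_mulVec_matrixLaw (x : Fin M → ℂ) :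
    (matrixLaw N M).map (fun A => Matrix.of A *ᵥ x) =
      complexGaussianVector (Fin N) (power x).toNNReal := by
  have hx : Measurable fun a : Fin M → ℂ => a ⬝ᵥ x := by unfold dotProduct; fun_prop
  exact (measurePreserving_pi _ _ fun _ =>
    ⟨hx, map_dotProduct_complexGaussianVector x⟩).map_eq

lemma measurable_observation (x : Fin M → ℂ) :
    Measurable fun p : (Fin N → Fin M → ℂ) × (Fin N → ℂ) => Matrix.of p.1 *ᵥ x + p.2 :=
  ((measurable_mulVec x).comp measurable_fst).add measurable_snd

lemma map_observation (ν : ℝ) (x : Fin M → ℂ) :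
    ((matrixLaw N M).prod (noiseLaw N ν)).map (fun p => Matrix.of p.1 *ᵥ x + p.2) =
      complexGaussianVector (Fin N) (power x + ν ^ 2).toNNReal := by
  rw [Real.toNNReal_add (power_nonneg x) (sq_nonneg ν), ← complexGaussianVector_conv,
    ← map_mulVec_matrixLaw, Measure.conv, ← Measure.map_id (μ := complexGaussianVector _ _),
    Measure.map_prod_map _ _ (measurable_mulVec x) measurable_id,
    Measure.map_map measurable_add ((measurable_mulVec x).prodMap measurable_id)]
  rfl

lemma ae_power_ne_zero {q : ℕ} (hq : 0 < q) {v : ℝ≥0} (hv : v ≠ 0) :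
    ∀ᵐ w ∂complexGaussianVector (Fin q) v, power w ≠ 0 := by
  filter_upwards [(measurePreserving_eval (fun _ : Fin q => complexGaussian v)
    ⟨0, hq⟩).quasiMeasurePreserving.ae (ae_ne_zero_complexGaussian hv)] with w hw h
  have h0 := (Finset.sum_eq_zero_iff_of_nonneg fun i _ => sq_nonneg ‖w i‖).1 h ⟨0, hq⟩
  exact hw (by simpa using h0)

/-! ### Large deviations of the power of a complex Gaussian vector -/

lemma mgf_sq_gaussianReal (v : ℝ≥0) {s : ℝ} (hs : 2 * s * v < 1) :
    mgf (fun x => x ^ 2) (gaussianReal 0 v) s = (√(1 - 2 * s * v))⁻¹ := by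
  rcases eq_or_ne v 0 with rfl | hv
  · simp [gaussianReal_zero_var, mgf_dirac']
  have hv' : (0 : ℝ) < v := by positivity
  have hs' : 1 - 2 * s * v ≠ 0 := by linarith
  have hdensity (x : ℝ) : gaussianPDFReal 0 v x • Real.exp (s * x ^ 2) =
      (√(2 * Real.pi * v))⁻¹ * Real.exp (-((1 - 2 * s * v) / (2 * v)) * x ^ 2) := by
    rw [gaussianPDFReal, smul_eq_mul, mul_assoc, ← Real.exp_add]
    congr 2
    field_simp [hv'.ne']
    ring
  simp only [mgf, integral_gaussianReal_eq_integral_smul hv, hdensity]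
  rw [integral_const_mul, integral_gaussian, ← Real.sqrt_inv, ← Real.sqrt_inv,
    ← Real.sqrt_mul (by positivity)]
  congr 1
  field_simp [hv'.ne', hs']

lemma mgf_norm_sq_complexGaussian (v : ℝ≥0) {s : ℝ} (hs : s * v < 1) :
    mgf (fun z => ‖z‖ ^ 2) (complexGaussian v) s = (1 - s * v)⁻¹ := by
  have hs2 : 2 * s * ((v / 2 : ℝ≥0) : ℝ) = s * v := by push_cast; ring
  have hsplit (p : ℝ × ℝ) : Real.exp (s * ‖(p.1 : ℂ) + p.2 * Complex.I‖ ^ 2) =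
      Real.exp (s * p.1 ^ 2) * Real.exp (s * p.2 ^ 2) := by
    rw [← Real.exp_add, Complex.sq_norm, Complex.normSq_add_mul_I, mul_add]
  have hmgf := mgf_sq_gaussianReal (v / 2) (s := s) (by rwa [hs2])
  rw [mgf, complexGaussian, integral_map (by fun_prop) (by fun_prop)]
  simp only [hsplit]
  rw [integral_prod_mul (fun x => Real.exp (s * x ^ 2)) fun x => Real.exp (s * x ^ 2)]
  change mgf _ _ s * mgf _ _ s = _
  rw [hmgf, hs2, ← mul_inv, Real.mul_self_sqrt (by linarith)]

lemma mgf_power {q : ℕ} (v : ℝ≥0) {s : ℝ} (hs : s * v < 1) :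
    mgf power (complexGaussianVector (Fin q) v) s = (1 - s * v)⁻¹ ^ q := by
  have hindep : iIndepFun (fun k (w : Fin q → ℂ) => ‖w k‖ ^ 2) (complexGaussianVector (Fin q) v) :=
    iIndepFun_pi (X := fun _ z => ‖z‖ ^ 2) fun _ => by fun_prop
  have hcoord (k : Fin q) : mgf (fun w : Fin q → ℂ => ‖w k‖ ^ 2)
      (complexGaussianVector (Fin q) v) s = (1 - s * v)⁻¹ := by
    have heval := measurePreserving_eval (fun _ : Fin q => complexGaussian v) k
    rw [← mgf_norm_sq_complexGaussian v hs, ← heval.map_eq]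
    exact (mgf_map heval.measurable.aemeasurable (by fun_prop : AEStronglyMeasurable
      (fun z : ℂ => Real.exp (s * ‖z‖ ^ 2)) _)).symm
  have hpower : (power : (Fin q → ℂ) → ℝ) = ∑ k, fun w => ‖w k‖ ^ 2 := by
    ext w
    simp [power]
  rw [hpower, hindep.mgf_sum (fun _ => by fun_prop)]
  simp [hcoord]

/-- The rate function of the exponential distribution of mean one, which is the law of `‖z‖ ^ 2` for
a complex Gaussian `z` of variance one; it governs the deviations of the power of a Gaussian vector.
-/
noncomputable def expRate (θ : ℝ) : ℝ := θ - 1 - Real.log θ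

lemma expRate_pos {θ : ℝ} (h0 : 0 < θ) (h1 : θ ≠ 1) : 0 < expRate θ := by
  have := Real.log_lt_sub_one_of_pos h0 h1
  unfold expRate
  linarith

lemma expRate_antitoneOn : AntitoneOn expRate (Set.Ioc 0 1) := by
  intro a ⟨ha, _⟩ b ⟨hb, hb1⟩ hab
  have hlog : 1 - a / b ≤ Real.log b - Real.log a := by
    rw [← Real.log_div hb.ne' ha.ne', ← inv_div b a]
    exact Real.one_sub_inv_le_log_of_pos (div_pos hb ha)
  have hslope : b - a ≤ 1 - a / b := by
    rw [one_sub_div hb.ne', le_div_iff₀ hb]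
    exact mul_le_of_le_one_right (sub_nonneg.2 hab) hb1
  unfold expRate
  linarith

section

variable {q : ℕ} {v : ℝ≥0} {t : ℝ}

-- `s = 1 / v - 1 / t` minimises `s ↦ exp (-s * q * t) * mgf power _ s`.
lemma exp_mul_mgf_power (hv : v ≠ 0) (ht : 0 < t) :
    Real.exp (-(1 / v - 1 / t) * (q * t)) *
        mgf power (complexGaussianVector (Fin q) v) (1 / v - 1 / t) =
      Real.exp (-(q * expRate (t / v))) := by
  have hv' : (0 : ℝ) < v := by positivity
  have hs : 1 - (1 / v - 1 / t) * v = v / t := by field_simp; ring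
  rw [mgf_power v (by linarith [div_pos hv' ht]), hs, inv_div,
    ← Real.exp_log (div_pos ht hv'), ← Real.exp_nat_mul, ← Real.exp_add,
    Real.exp_log (div_pos ht hv'), expRate]
  congr 1
  field_simp
  ring

lemma integrable_exp_mul_power (hv : v ≠ 0) (ht : 0 < t) :
    Integrable (fun w => Real.exp ((1 / v - 1 / t) * power w))
      (complexGaussianVector (Fin q) v) :=
  mgf_pos_iff.1 (pos_of_mul_pos_right
    ((exp_mul_mgf_power hv ht).symm ▸ Real.exp_pos _) (Real.exp_pos _).le)

lemma measure_power_le_le_exp (ht : 0 < t) (htv : t ≤ v) :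
    complexGaussianVector (Fin q) v {w | power w ≤ q * t} ≤
      ENNReal.ofReal (Real.exp (-(q * expRate (t / v)))) := by
  have hv : v ≠ 0 := by rintro rfl; exact (ht.trans_le htv).ne' rfl
  have hs : 1 / (v : ℝ) - 1 / t ≤ 0 := sub_nonpos.2 (one_div_le_one_div_of_le ht htv)
  rw [← exp_mul_mgf_power hv ht, ← ofReal_measureReal]
  exact ENNReal.ofReal_le_ofReal
    (measure_le_le_exp_mul_mgf _ hs (integrable_exp_mul_power hv ht))

lemma measure_le_power_le_exp (hv : v ≠ 0) (hvt : v ≤ t) :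
    complexGaussianVector (Fin q) v {w | q * t ≤ power w} ≤
      ENNReal.ofReal (Real.exp (-(q * expRate (t / v)))) := by
  have hv' : (0 : ℝ) < v := by positivity
  have ht : 0 < t := hv'.trans_le hvt
  have hs : 0 ≤ 1 / (v : ℝ) - 1 / t := sub_nonneg.2 (one_div_le_one_div_of_le hv' hvt)
  rw [← exp_mul_mgf_power hv ht, ← ofReal_measureReal]
  exact ENNReal.ofReal_le_ofReal
    (measure_ge_le_exp_mul_mgf _ hs (integrable_exp_mul_power hv ht))

end

/-! ### The projection onto the orthogonal complement of the column space -/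

section

variable {κ : Type} [Fintype κ] [DecidableEq κ] {B : Matrix (Fin N) κ ℂ}

open scoped ComplexOrder in
lemma isUnit_det_conjTranspose_mul_self (hB : B.rank = Fintype.card κ) : IsUnit (Bᴴ * B).det := by
  rw [← Matrix.isUnit_iff_isUnit_det, ← Matrix.linearIndependent_cols_iff_isUnit,
    linearIndependent_iff_card_eq_finrank_span, Set.finrank, ← Matrix.rank_eq_finrank_span_cols,
    Matrix.rank_conjTranspose_mul_self, hB]

lemma perpProj_mul_self (hB : B.rank = Fintype.card κ) : perpProj B * B = 0 := by
  rw [perpProj, Matrix.sub_mul, Matrix.one_mul, Matrix.mul_assoc, Matrix.mul_assoc,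
    Matrix.nonsing_inv_mul _ (isUnit_det_conjTranspose_mul_self hB), Matrix.mul_one, sub_self]

lemma isStarProjection_perpProj (hB : B.rank = Fintype.card κ) :
    IsStarProjection (perpProj B) where
  isIdempotentElem := by
    change perpProj B * (1 - B * (Bᴴ * B)⁻¹ * Bᴴ) = _
    rw [Matrix.mul_sub, Matrix.mul_one, Matrix.mul_assoc B, ← Matrix.mul_assoc _ B,
      perpProj_mul_self hB, Matrix.zero_mul, sub_zero]
  isSelfAdjoint := by
    rw [isSelfAdjoint_iff, Matrix.star_eq_conjTranspose]
    simp [perpProj, Matrix.conjTranspose_mul, Matrix.conjTranspose_nonsing_inv, Matrix.mul_assoc]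

lemma trace_perpProj (hB : B.rank = Fintype.card κ) :
    (perpProj B).trace = ((N - Fintype.card κ : ℕ) : ℂ) := by
  have hκ : Fintype.card κ ≤ N := by simpa [hB] using B.rank_le_card_height
  rw [perpProj, Matrix.trace_sub, Matrix.trace_mul_comm, ← Matrix.mul_assoc,
    Matrix.mul_nonsing_inv _ (isUnit_det_conjTranspose_mul_self hB)]
  simp [hκ]

lemma exists_conjTranspose_mul_self_eq_of_isStarProjection {𝕜 n : Type*} [RCLike 𝕜] [Fintype n]
    {P : Matrix n n 𝕜} (hP : IsStarProjection P) {q : ℕ} (hq : P.trace = q) :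
    ∃ U : Matrix (Fin q) n 𝕜, U * Uᴴ = 1 ∧ Uᴴ * U = P := by
  classical
  have hH : P.IsHermitian := hP.isSelfAdjoint
  have heig (i : n) : (hH.eigenvalues i : 𝕜) = if hH.eigenvalues i = 1 then 1 else 0 := by
    rcases hP.isIdempotentElem.spectrum_subset ℝ (hH.eigenvalues_mem_spectrum_real i) with h | h
    · simp [h]
    · simp [Set.mem_singleton_iff.1 h]
  have hcard : Fintype.card {i // hH.eigenvalues i = 1} = q := by
    rw [hH.trace_eq_sum_eigenvalues, Finset.sum_congr rfl fun i _ => heig i] at hq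
    rw [Fintype.card_subtype]
    simpa using hq
  let e : Fin q ≃ {i // hH.eigenvalues i = 1} := (Fintype.equivFinOfCardEq hcard).symm
  obtain ⟨V, hV, hPV⟩ : ∃ V : Matrix n n 𝕜, Vᴴ * V = 1 ∧
      P = V * Matrix.diagonal (RCLike.ofReal ∘ hH.eigenvalues) * Vᴴ :=
    ⟨hH.eigenvectorUnitary, Unitary.coe_star_mul_self _, by
      conv_lhs => rw [hH.spectral_theorem, Unitary.conjStarAlgAut_apply]
      rfl⟩
  refine ⟨Vᴴ.submatrix (fun k => (e k : n)) id, ?_, ?_⟩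
  · rw [Matrix.conjTranspose_submatrix, Matrix.conjTranspose_conjTranspose,
      ← Matrix.submatrix_mul _ _ _ id _ Function.bijective_id, hV]
    exact Matrix.submatrix_one _ (Subtype.val_injective.comp e.injective)
  · ext i j
    calc ((Vᴴ.submatrix (fun k => (e k : n)) id)ᴴ * Vᴴ.submatrix (fun k => (e k : n)) id) i j
        = ∑ k, V i (e k) * star (V j (e k)) := by simp [Matrix.mul_apply]
      _ = ∑ l : {l // hH.eigenvalues l = 1}, V i l * star (V j l) :=
        e.sum_comp fun l => V i l * star (V j l)
      _ = ∑ l with hH.eigenvalues l = 1, V i l * star (V j l) :=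
        (Finset.sum_subtype _ (by simp) fun l => V i l * star (V j l)).symm
      _ = ∑ l, V i l * hH.eigenvalues l * star (V j l) := by
        simp [Finset.sum_filter, heig]
      _ = P i j := by
        rw [congrFun₂ hPV i j, Matrix.mul_apply]
        simp

-- Both sides are the quadratic form of `Sᴴ * S = Tᴴ * T`.
lemma power_mulVec_eq_of_conjTranspose_mul_self_eq {q r : ℕ} {S : Matrix (Fin q) (Fin N) ℂ}
    {T : Matrix (Fin r) (Fin N) ℂ} (h : Sᴴ * S = Tᴴ * T) (w : Fin N → ℂ) :
    power (S *ᵥ w) = power (T *ᵥ w) := by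
  have hquad {m : ℕ} (R : Matrix (Fin m) (Fin N) ℂ) :
      (power (R *ᵥ w) : ℂ) = w ⬝ᵥ star ((Rᴴ * R) *ᵥ w) := by
    rw [ofReal_power, ← Matrix.mulVec_mulVec, Matrix.star_mulVec _ (R *ᵥ w),
      Matrix.conjTranspose_conjTranspose, dotProduct_comm, dotProduct_comm w,
      ← Matrix.dotProduct_mulVec]
  exact_mod_cast (hquad S).trans (h ▸ (hquad T).symm)

lemma measurable_power_mulVec {q : ℕ} (T : Matrix (Fin q) (Fin N) ℂ) :
    Measurable fun w => power (T *ᵥ w) :=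
  measurable_power.comp (continuous_const.matrix_mulVec continuous_id).measurable

lemma map_power_perpProj_mulVec (hB : B.rank = Fintype.card κ) (v : ℝ≥0) :
    (complexGaussianVector (Fin N) v).map (fun w => power (perpProj B *ᵥ w)) =
      (complexGaussianVector (Fin (N - Fintype.card κ)) v).map power := by
  have hP := isStarProjection_perpProj hB
  obtain ⟨U, hU, hUP⟩ :=
    exists_conjTranspose_mul_self_eq_of_isStarProjection hP (trace_perpProj hB)
  have hPP : (perpProj B)ᴴ * perpProj B = Uᴴ * U := by
    rw [hUP, ← Matrix.star_eq_conjTranspose, hP.isSelfAdjoint.star_eq, hP.isIdempotentElem.eq]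
  have hlaw := map_mulVec_complexGaussianVector U 1 v (by simpa using hU)
  rw [one_mul] at hlaw
  rw [← hlaw, Measure.map_map (measurable_power) (Continuous.measurable (by fun_prop))]
  congr 1 with w
  exact power_mulVec_eq_of_conjTranspose_mul_self_eq hPP w

end

/-! ### Resampling the columns outside an index set -/

lemma map_prod_eq_of_ae {X Y Z : Type*} [MeasurableSpace X] [MeasurableSpace Y]
    [MeasurableSpace Z] {μ : Measure X} [IsProbabilityMeasure μ] {ν : Measure Y} [SFinite ν]
    {ρ : Measure Z} {f : X × Y → Z} (hf : Measurable f)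
    (h : ∀ᵐ a ∂μ, ν.map (fun b => f (a, b)) = ρ) : (μ.prod ν).map f = ρ := by
  ext s hs
  have hsection : ∀ᵐ a ∂μ, ν (Prod.mk a ⁻¹' (f ⁻¹' s)) = ρ s := by
    filter_upwards [h] with a ha
    rw [← ha, Measure.map_apply (by fun_prop) hs]
    rfl
  rw [Measure.map_apply hf hs, Measure.prod_apply (hf hs), lintegral_congr_ae hsection]
  simp

lemma measurePreserving_pi_prod {ι X Y Z : Type*} [Fintype ι] [MeasurableSpace X]
    [MeasurableSpace Y] [MeasurableSpace Z] {μ : ι → Measure X} {ν : ι → Measure Y}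
    {ρ : ι → Measure Z} [∀ i, SigmaFinite (μ i)] [∀ i, SigmaFinite (ν i)]
    [∀ i, SigmaFinite (ρ i)] {f : ι → X × Y → Z}
    (hf : ∀ i, MeasurePreserving (f i) ((μ i).prod (ν i)) (ρ i)) :
    MeasurePreserving (fun (p : (ι → X) × (ι → Y)) i => f i (p.1 i, p.2 i))
      ((Measure.pi μ).prod (Measure.pi ν)) (Measure.pi ρ) :=
  (measurePreserving_pi _ _ hf).comp (measurePreserving_arrowProdEquivProdArrow X Y ι μ ν).symm

lemma measurePreserving_piecewise {ι X : Type*} [Fintype ι] [DecidableEq ι] [MeasurableSpace X]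
    (μ : ι → Measure X) [∀ i, IsProbabilityMeasure (μ i)] (J : Finset ι) :
    MeasurePreserving (fun p : (ι → X) × (ι → X) => J.piecewise p.1 p.2)
      ((Measure.pi μ).prod (Measure.pi μ)) (Measure.pi μ) := by
  refine measurePreserving_pi_prod (f := fun i p => if i ∈ J then p.1 else p.2) fun i => ?_
  by_cases hi : i ∈ J
  · simpa only [hi, if_true] using measurePreserving_fst
  · simpa only [hi, if_false] using measurePreserving_snd

lemma measurePreserving_resample_columns (J : Finset (Fin M)) :
    MeasurePreserving
      (fun (p : (Fin N → Fin M → ℂ) × (Fin N → Fin M → ℂ)) i => J.piecewise (p.1 i) (p.2 i))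
      ((matrixLaw N M).prod (matrixLaw N M)) (matrixLaw N M) :=
  measurePreserving_pi_prod (f := fun _ p => J.piecewise p.1 p.2)
    fun _ => measurePreserving_piecewise _ J

lemma columns_piecewise (A A' : Fin N → Fin M → ℂ) (J : Finset (Fin M)) :
    columns (fun i => J.piecewise (A i) (A' i)) J = columns A J := by
  ext i j
  simp [columns]

lemma mulVec_piecewise (A A' : Fin N → Fin M → ℂ) (J : Finset (Fin M)) (x : Fin M → ℂ) :
    Matrix.of (fun i => J.piecewise (A i) (A' i)) *ᵥ x =
      columns A J *ᵥ (fun j => x j) + Matrix.of A' *ᵥ J.piecewise 0 x := by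
  ext i
  simp only [Matrix.mulVec, dotProduct, Pi.add_apply, Matrix.of_apply, columns]
  rw [Finset.sum_coe_sort J (fun j => A i j * x j), ← Finset.sum_ite_mem_eq J,
    ← Finset.sum_add_distrib]
  refine Finset.sum_congr rfl fun j _ => ?_
  by_cases hj : j ∈ J <;> simp [hj]

/-! ### The power of the residual of the observation -/

/-- The power of the residual `Π y` of the observation `y = A x + n`, where `Π` projects onto the
orthogonal complement of the columns of `A` in `J`, as a function of the pair `(A, n)`. This is the
statistic that decides whether `J` is jointly typical with `y`. -/
noncomputable def residualPower (x : Fin M → ℂ) (J : Finset (Fin M))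
    (p : (Fin N → Fin M → ℂ) × (Fin N → ℂ)) : ℝ :=
  power (perpProj (columns p.1 J) *ᵥ (Matrix.of p.1 *ᵥ x + p.2))

-- The inverse is written through the adjugate, so that only `det⁻¹` is discontinuous.
lemma perpProj_mulVec {κ : Type} [Fintype κ] [DecidableEq κ] (B : Matrix (Fin N) κ ℂ)
    (y : Fin N → ℂ) :
    perpProj B *ᵥ y = y - (Bᴴ * B).det⁻¹ • ((B * (Bᴴ * B).adjugate * Bᴴ) *ᵥ y) := by
  simp [perpProj, Matrix.inv_def, Matrix.sub_mulVec, Matrix.smul_mulVec]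

@[fun_prop]
lemma measurable_residualPower (x : Fin M → ℂ) (J : Finset (Fin M)) :
    Measurable (residualPower (N := N) x J) := by
  have hB : Continuous fun p : (Fin N → Fin M → ℂ) × (Fin N → ℂ) => columns p.1 J := by
    refine continuous_matrix fun i j => ?_
    change Continuous fun p : (Fin N → Fin M → ℂ) × (Fin N → ℂ) => p.1 i j
    fun_prop
  have hy : Continuous fun p : (Fin N → Fin M → ℂ) × (Fin N → ℂ) => Matrix.of p.1 *ᵥ x + p.2 := by
    fun_prop
  have hB' := hB.matrix_conjTranspose
  have hG := hB'.matrix_mul hB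
  unfold residualPower
  simp only [perpProj_mulVec]
  exact measurable_power.comp (hy.measurable.sub (hG.matrix_det.measurable.inv.smul
    (((hB.matrix_mul hG.matrix_adjugate).matrix_mul hB').matrix_mulVec hy).measurable))

-- The columns in `J` are killed by the projection, and the others may be replaced by an independent
-- copy, so that given the columns in `J` the projection is applied to a Gaussian vector.
lemma map_residualPower (ν : ℝ) (x : Fin M → ℂ) {J : Finset (Fin M)}
    (h : ∀ᵐ A ∂matrixLaw N M, (columns A J).rank = J.card) :
    ((matrixLaw N M).prod (noiseLaw N ν)).map (residualPower x J) =
      (complexGaussianVector (Fin (N - J.card))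
        (power (J.piecewise 0 x) + ν ^ 2).toNNReal).map power := by
  have hΦ := ((measurePreserving_resample_columns (N := N) J).prod
    (MeasurePreserving.id (noiseLaw N ν))).comp
    (measurePreserving_prodAssoc (matrixLaw N M) (matrixLaw N M) (noiseLaw N ν)).symm
  rw [← hΦ.map_eq, Measure.map_map (by fun_prop) hΦ.measurable]
  refine map_prod_eq_of_ae ((measurable_residualPower x J).comp hΦ.measurable) ?_
  filter_upwards [h] with A hA
  have hB : (columns A J).rank = Fintype.card J := by simpa using hA
  have hmap := map_power_perpProj_mulVec hB (power (J.piecewise 0 x) + ν ^ 2).toNNReal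
  rw [Fintype.card_coe, ← map_observation,
    Measure.map_map (measurable_power_mulVec _) (measurable_observation _)] at hmap
  refine Eq.trans (congrArg (Measure.map · _) (funext fun p => ?_)) hmap
  change power (perpProj (columns (fun i => J.piecewise (A i) (p.1 i)) J) *ᵥ
    (Matrix.of (fun i => J.piecewise (A i) (p.1 i)) *ᵥ x + p.2)) = _
  rw [columns_piecewise, mulVec_piecewise, add_assoc, Matrix.mulVec_add _ (columns A J *ᵥ _),
    Matrix.mulVec_mulVec, perpProj_mul_self hB, Matrix.zero_mulVec, zero_add]
  rfl

lemma rank_columns_eq_card_iff (A : Fin N → Fin M → ℂ) (J : Finset (Fin M)) :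
    (columns A J).rank = J.card ↔ LinearIndepOn ℂ (fun j i => A i j) (J : Set (Fin M)) := by
  change _ ↔ LinearIndependent ℂ (columns A J).col
  rw [linearIndependent_iff_card_eq_finrank_span, Set.finrank,
    ← Matrix.rank_eq_finrank_span_cols, Fintype.card_coe, eq_comm]

lemma rank_columns_insert {A : Fin N → Fin M → ℂ} {J : Finset (Fin M)} {j : Fin M} (hj : j ∉ J)
    (hA : (columns A J).rank = J.card)
    (h : residualPower (Pi.single j 1) J (A, 0) ≠ 0) :
    (columns A (insert j J)).rank = (insert j J).card := by
  have hA' := (rank_columns_eq_card_iff A J).1 hA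
  rw [rank_columns_eq_card_iff, Finset.coe_insert, linearIndepOn_insert (by simpa using hj)]
  refine ⟨hA', fun hmem => h ?_⟩
  have himg : (fun j i => A i j) '' (J : Set (Fin M)) = Set.range (columns A J).col := by
    rw [Set.image_eq_range]
    rfl
  rw [himg, ← Matrix.range_mulVecLin] at hmem
  obtain ⟨z, hz⟩ := hmem
  have hcol : Matrix.of A *ᵥ Pi.single j 1 = columns A J *ᵥ z := by
    rw [← Matrix.mulVecLin_apply (columns A J), hz]
    ext i
    simp
  rw [residualPower, add_zero, hcol, Matrix.mulVec_mulVec, perpProj_mul_self (by simpa using hA)]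
  simp [power]

lemma noiseLaw_zero : noiseLaw N 0 = Measure.dirac 0 := by
  simp [noiseLaw, complexGaussianVector_zero]

lemma ae_residualPower_single_ne_zero {J : Finset (Fin M)} {j : Fin M} (hj : j ∉ J)
    (hJ : J.card < N) (h : ∀ᵐ A ∂matrixLaw N M, (columns A J).rank = J.card) :
    ∀ᵐ A ∂matrixLaw N M, residualPower (Pi.single j 1) J (A, 0) ≠ 0 := by
  have hx : power (J.piecewise 0 (Pi.single j 1)) = 1 := by
    have hsingle : J.piecewise 0 (Pi.single j 1) = (Pi.single j 1 : Fin M → ℂ) := by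
      ext k
      by_cases hk : k ∈ J
      · simp [hk, ne_of_mem_of_not_mem hk hj]
      · simp [hk]
    rw [hsingle, power, Finset.sum_eq_single j] <;> aesop
  have hne : ∀ᵐ t ∂(complexGaussianVector (Fin (N - J.card)) 1).map power, t ≠ 0 :=
    (ae_map_iff (by fun_prop) (measurableSet_singleton (0 : ℝ)).compl).2
      (ae_power_ne_zero (by omega) one_ne_zero)
  have hlaw := map_residualPower (ν := 0) (Pi.single j 1) h
  rw [hx, noiseLaw_zero, Measure.prod_dirac, Measure.map_map (by fun_prop) (by fun_prop)] at hlaw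
  rw [zero_pow two_ne_zero, add_zero, Real.toNNReal_one] at hlaw
  rw [← hlaw] at hne
  exact ae_of_ae_map (p := (· ≠ 0)) (by fun_prop) hne

lemma ae_rank_columns (J : Finset (Fin M)) (hJ : J.card ≤ N) :
    ∀ᵐ A ∂(matrixLaw N M), (columns A J).rank = J.card := by
  induction J using Finset.induction with
  | empty => exact .of_forall fun A => by simpa using (columns A ∅).rank_le_card_width
  | insert j J hj ih =>
    rw [Finset.card_insert_of_notMem hj] at hJ
    have hrank := ih (by omega)
    filter_upwards [hrank, ae_residualPower_single_ne_zero hj (by omega) hrank] with A hA hres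
    exact rank_columns_insert hj hA hres

section

variable {x : Fin M → ℂ} {J : Finset (Fin M)} {L : ℕ} {α ν δ t : ℝ} {D : Decoder N M}

lemma measure_residualPower_mem (ν : ℝ) (x : Fin M → ℂ) (hJ : J.card ≤ N) {s : Set ℝ}
    (hs : MeasurableSet s) :
    ((matrixLaw N M).prod (noiseLaw N ν)) {p | residualPower x J p ∈ s} =
      complexGaussianVector (Fin (N - J.card)) (power (J.piecewise 0 x) + ν ^ 2).toNNReal
        {w | power w ∈ s} := by
  have h := congrFun (congrArg (⇑) (map_residualPower ν x (ae_rank_columns J hJ))) s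
  rwa [Measure.map_apply (by fun_prop) hs, Measure.map_apply (by fun_prop) hs] at h

lemma measure_residualPower_le_le_exp {v : ℝ} (hJ : J.card ≤ N) (ht : 0 < t) (htv : t ≤ v)
    (hv : v ≤ power (J.piecewise 0 x) + ν ^ 2) :
    ((matrixLaw N M).prod (noiseLaw N ν)) {p | residualPower x J p ≤ (N - J.card : ℕ) * t} ≤
      ENNReal.ofReal (Real.exp (-((N - J.card : ℕ) * expRate (t / v)))) := by
  set V := power (J.piecewise 0 x) + ν ^ 2
  have hv0 : 0 < v := ht.trans_le htv
  have hV0 : 0 < V := hv0.trans_le hv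
  have hV : ((V.toNNReal : ℝ≥0) : ℝ) = V := Real.coe_toNNReal _ hV0.le
  have hrate : expRate (t / v) ≤ expRate (t / V) :=
    expRate_antitoneOn ⟨by positivity, (div_le_one hV0).2 (htv.trans hv)⟩
      ⟨by positivity, (div_le_one hv0).2 htv⟩ (by gcongr)
  calc ((matrixLaw N M).prod (noiseLaw N ν)) {p | residualPower x J p ≤ (N - J.card : ℕ) * t}
      = complexGaussianVector (Fin (N - J.card)) V.toNNReal
          {w | power w ≤ (N - J.card : ℕ) * t} :=
        measure_residualPower_mem ν x hJ measurableSet_Iic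
    _ ≤ ENNReal.ofReal (Real.exp (-((N - J.card : ℕ) * expRate (t / V)))) := by
        simpa only [hV] using
          measure_power_le_le_exp (v := V.toNNReal) ht (by rw [hV]; exact htv.trans hv)
    _ ≤ ENNReal.ofReal (Real.exp (-((N - J.card : ℕ) * expRate (t / v)))) := by gcongr

lemma measure_le_residualPower_le_exp (hJ : J.card ≤ N)
    (h0 : 0 < power (J.piecewise 0 x) + ν ^ 2) (ht : power (J.piecewise 0 x) + ν ^ 2 ≤ t) :
    ((matrixLaw N M).prod (noiseLaw N ν)) {p | (N - J.card : ℕ) * t ≤ residualPower x J p} ≤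
      ENNReal.ofReal (Real.exp (-((N - J.card : ℕ) *
        expRate (t / (power (J.piecewise 0 x) + ν ^ 2))))) := by
  have hV := Real.coe_toNNReal _ h0.le
  have htail := measure_le_power_le_exp (q := N - J.card)
    (Real.toNNReal_pos.2 h0).ne' (hV.trans_le ht)
  rw [hV] at htail
  exact (measure_residualPower_mem ν x hJ measurableSet_Ici).trans_le htail

/-! ### Typical sets and decoding errors -/

lemma piecewise_supp (x : Fin M → ℂ) : (supp x).piecewise 0 x = 0 := by
  ext i
  by_cases hi : x i = 0 <;> simp [supp, hi]

lemma power_zero : power (0 : Fin M → ℂ) = 0 := by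
  simp [power]

lemma mul_minMod_sq_le_power_piecewise (x : Fin M → ℂ) (J : Finset (Fin M)) :
    (supp x \ J).card * minMod x ^ 2 ≤ power (J.piecewise 0 x) := by
  have hmin : 0 ≤ minMod x := Real.iInf_nonneg fun _ => norm_nonneg _
  calc (supp x \ J).card * minMod x ^ 2 = ∑ _j ∈ supp x \ J, minMod x ^ 2 := by simp
    _ ≤ ∑ j ∈ supp x \ J, ‖J.piecewise 0 x j‖ ^ 2 := by
        refine Finset.sum_le_sum fun j hj => ?_
        obtain ⟨hjx, hjJ⟩ := Finset.mem_sdiff.1 hj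
        have hle : minMod x ≤ ‖x j‖ := ciInf_le (f := fun i : supp x => ‖x i‖)
          ⟨0, by rintro _ ⟨_, rfl⟩; exact norm_nonneg _⟩ ⟨j, hjx⟩
        rw [Finset.piecewise_eq_of_notMem _ _ _ hjJ]
        gcongr
    _ ≤ power (J.piecewise 0 x) := Finset.sum_le_univ_sum_of_nonneg fun _ => sq_nonneg _

lemma mul_card_supp_le_card_sdiff_of_not_recovers (h : ¬ Recovers α x J) :
    α * (supp x).card ≤ (supp x \ J).card := by
  have hsplit : ((supp x \ J).card : ℝ) + (J ∩ supp x).card = (supp x).card := by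
    rw [Finset.inter_comm]
    exact_mod_cast Finset.card_sdiff_add_card_inter (supp x) J
  rcases (supp x).card.cast_nonneg (α := ℝ) |>.eq_or_lt with h0 | h0
  · rw [← h0, mul_zero]
    positivity
  · rw [Recovers, gt_iff_lt, not_lt, div_le_iff₀ h0] at h
    linarith

lemma le_power_piecewise_of_not_recovers {c : ℝ} (hα : 0 ≤ α)
    (hc : c ≤ (supp x).card * minMod x ^ 2) (h : ¬ Recovers α x J) :
    α * c ≤ power (J.piecewise 0 x) :=
  calc α * c ≤ α * ((supp x).card * minMod x ^ 2) := by gcongr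
    _ = α * (supp x).card * minMod x ^ 2 := by ring
    _ ≤ (supp x \ J).card * minMod x ^ 2 := by
        gcongr
        exact mul_card_supp_le_card_sdiff_of_not_recovers h
    _ ≤ power (J.piecewise 0 x) := mul_minMod_sq_le_power_piecewise x J

lemma jointlyTypical_iff (hN : 0 < N) {p : (Fin N → Fin M → ℂ) × (Fin N → ℂ)} :
    JointlyTypical L ν δ p.1 (Matrix.of p.1 *ᵥ x + p.2) J ↔
      J.card = L ∧ (columns p.1 J).rank = L ∧
        |residualPower x J p - (N - L) * ν ^ 2| < N * δ := by
  have hN' : (0 : ℝ) < N := by exact_mod_cast hN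
  have hdiv : 1 / (N : ℝ) * residualPower x J p - ((N : ℝ) - L) / N * ν ^ 2 =
      (residualPower x J p - (N - L) * ν ^ 2) / N := by ring
  rw [← div_lt_iff₀' hN', ← abs_of_pos hN', ← abs_div, abs_of_pos hN', ← hdiv]
  rfl

lemma JointlyTypical.residualPower_le {p : (Fin N → Fin M → ℂ) × (Fin N → ℂ)}
    (h : JointlyTypical L ν δ p.1 (Matrix.of p.1 *ᵥ x + p.2) J) (hN : 0 < N) (hL : 2 * L ≤ N) :
    residualPower x J p ≤ (N - L : ℕ) * (ν ^ 2 + 2 * δ) := by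
  obtain ⟨-, -, hlt⟩ := (jointlyTypical_iff hN).1 h
  have hδ : 0 < δ := (abs_nonneg _).trans_lt h.2.2
  have hL' : 2 * (L : ℝ) ≤ N := by exact_mod_cast hL
  rw [Nat.cast_sub (by omega)]
  nlinarith [(abs_lt.1 hlt).2]

lemma residualPower_le_or_le_of_not_jointlyTypical {p : (Fin N → Fin M → ℂ) × (Fin N → ℂ)}
    (h : ¬ JointlyTypical J.card ν δ p.1 (Matrix.of p.1 *ᵥ x + p.2) J)
    (hrank : (columns p.1 J).rank = J.card) (hδ : 0 ≤ δ) (hN : 0 < N) (hJ : J.card ≤ N) :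
    residualPower x J p ≤ (N - J.card : ℕ) * (ν ^ 2 - δ) ∨
      (N - J.card : ℕ) * (ν ^ 2 + δ) ≤ residualPower x J p := by
  have hge : N * δ ≤ |residualPower x J p - (N - J.card) * ν ^ 2| :=
    not_lt.1 fun hlt => h ((jointlyTypical_iff hN).2 ⟨rfl, hrank, hlt⟩)
  have hJδ : 0 ≤ J.card * δ := by positivity
  rw [Nat.cast_sub hJ]
  rcases le_abs'.1 hge with hlow | hhigh
  · exact .inl (by linarith)
  · exact .inr (by linarith)

/-- The pairs of a measurement matrix and a noise vector for which the decoder `D` fails to recover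
`x`. -/
def errorEvent (α : ℝ) (D : Decoder N M) (x : Fin M → ℂ) :
    Set ((Fin N → Fin M → ℂ) × (Fin N → ℂ)) :=
  {p | ¬ Recovers α x (D p.1 (Matrix.of p.1 *ᵥ x + p.2))}

lemma measurableSet_errorEvent (hD : IsJointTypicalityDecoder L ν δ D) (x : Fin M → ℂ) :
    MeasurableSet (errorEvent α D x) := by
  have hunion : errorEvent α D x = ⋃ J ∈ {J : Finset (Fin M) | ¬ Recovers α x J},
      (fun p : (Fin N → Fin M → ℂ) × (Fin N → ℂ) => (p.1, Matrix.of p.1 *ᵥ x + p.2)) ⁻¹'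
        {p | D p.1 p.2 = J} := by
    ext p
    simp [errorEvent]
  rw [hunion]
  exact .biUnion (Set.to_countable _) fun J _ =>
    (hD.measurable J).preimage (measurable_fst.prodMk (measurable_observation x))

lemma avgErrProb_eq (hD : IsJointTypicalityDecoder L ν δ D) (x : Fin M → ℂ) :
    avgErrProb α ν D x = ((matrixLaw N M).prod (noiseLaw N ν)) (errorEvent α D x) :=
  (Measure.prod_apply (measurableSet_errorEvent hD x)).symm

lemma measure_lt_errProb_le_div (hD : IsJointTypicalityDecoder L ν δ D) (x : Fin M → ℂ) {ξ : ℝ}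
    (hξ : 0 < ξ) :
    matrixLaw N M {A | errProb α ν D x A > ENNReal.ofReal ξ} ≤
      avgErrProb α ν D x / ENNReal.ofReal ξ :=
  (measure_mono fun A (hA : errProb α ν D x A > _) => hA.le).trans <| meas_ge_le_lintegral_div
    (measurable_measure_prodMk_left (measurableSet_errorEvent hD x)).aemeasurable
    (ENNReal.ofReal_pos.2 hξ).ne' ENNReal.ofReal_ne_top

lemma errorEvent_subset (hD : IsJointTypicalityDecoder (supp x).card ν δ D) (hδ : 0 ≤ δ)
    (hN : 0 < N) (hL : 2 * (supp x).card ≤ N) :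
    errorEvent α D x ⊆
      {p | (columns p.1 (supp x)).rank ≠ (supp x).card} ∪
      {p | residualPower x (supp x) p ≤ (N - (supp x).card : ℕ) * (ν ^ 2 - δ)} ∪
      {p | (N - (supp x).card : ℕ) * (ν ^ 2 + δ) ≤ residualPower x (supp x) p} ∪
      ⋃ J ∈ {J : Finset (Fin M) | J.card = (supp x).card ∧ ¬ Recovers α x J},
        {p | residualPower x J p ≤ (N - J.card : ℕ) * (ν ^ 2 + 2 * δ)} := by
  intro p hp
  by_cases htyp :
    JointlyTypical (supp x).card ν δ p.1 (Matrix.of p.1 *ᵥ x + p.2) (supp x)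
  · have hout := hD.typical _ _ ⟨_, htyp⟩
    refine .inr (Set.mem_biUnion ⟨hout.1, hp⟩ ?_)
    rw [Set.mem_ofPred_eq, hout.1]
    exact hout.residualPower_le hN hL
  · by_cases hrank : (columns p.1 (supp x)).rank = (supp x).card
    · rcases residualPower_le_or_le_of_not_jointlyTypical htyp hrank hδ hN (by omega)
        with hlow | hhigh
      · exact .inl (.inl (.inr hlow))
      · exact .inl (.inr hhigh)
    · exact .inl (.inl (.inl hrank))

lemma measure_biUnion_le_two_pow_mul {Ω : Type*} [MeasurableSpace Ω] (μ : Measure Ω)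
    {F : Set (Finset (Fin M))} {s : Finset (Fin M) → Set Ω} {b : ℝ≥0∞}
    (h : ∀ J ∈ F, μ (s J) ≤ b) : μ (⋃ J ∈ F, s J) ≤ 2 ^ M * b := by
  classical
  have hcard : F.toFinset.card ≤ 2 ^ M := (Finset.card_le_univ _).trans_eq (by simp)
  calc μ (⋃ J ∈ F, s J) = μ (⋃ J ∈ F.toFinset, s J) := by simp only [Set.mem_toFinset]
    _ ≤ ∑ J ∈ F.toFinset, μ (s J) := measure_biUnion_finset_le _ _
    _ ≤ F.toFinset.card • b :=
        Finset.sum_le_card_nsmul _ _ _ fun J hJ => h J (Set.mem_toFinset.1 hJ)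
    _ ≤ 2 ^ M * b := by
        rw [nsmul_eq_mul]
        gcongr
        exact_mod_cast hcard

lemma avgErrProb_le {c : ℝ} (hD : IsJointTypicalityDecoder (supp x).card ν δ D) (hα : 0 ≤ α)
    (hc : c ≤ (supp x).card * minMod x ^ 2) (hδ : 0 ≤ δ) (hδν : δ < ν ^ 2) (hδc : 2 * δ ≤ α * c)
    (hN : 0 < N) (hL : 2 * (supp x).card ≤ N) :
    avgErrProb α ν D x ≤
      ENNReal.ofReal (Real.exp (-((N - (supp x).card : ℕ) * expRate ((ν ^ 2 - δ) / ν ^ 2)))) +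
      ENNReal.ofReal (Real.exp (-((N - (supp x).card : ℕ) * expRate ((ν ^ 2 + δ) / ν ^ 2)))) +
      2 ^ M * ENNReal.ofReal (Real.exp (-((N - (supp x).card : ℕ) *
        expRate ((ν ^ 2 + 2 * δ) / (α * c + ν ^ 2))))) := by
  set S := supp x
  set μ := (matrixLaw N M).prod (noiseLaw N ν)
  have hS : S.card ≤ N := by omega
  have hν : 0 < ν ^ 2 := hδ.trans_lt hδν
  have hV : power (S.piecewise 0 x) + ν ^ 2 = ν ^ 2 := by
    rw [piecewise_supp, power_zero, zero_add]
  have hrank : μ {p | (columns p.1 S).rank ≠ S.card} = 0 :=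
    Measure.quasiMeasurePreserving_fst.ae (ae_rank_columns S hS)
  have hlow := measure_residualPower_le_le_exp (x := x) (ν := ν) hS (sub_pos.2 hδν)
    (sub_le_self _ hδ) hV.ge
  have hhigh := measure_le_residualPower_le_exp (x := x) (ν := ν) (t := ν ^ 2 + δ) hS
    (by rwa [hV]) (by rw [hV]; linarith)
  rw [hV] at hhigh
  have hmissed : μ (⋃ J ∈ {J : Finset (Fin M) | J.card = S.card ∧ ¬ Recovers α x J},
      {p | residualPower x J p ≤ (N - J.card : ℕ) * (ν ^ 2 + 2 * δ)}) ≤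
      2 ^ M * ENNReal.ofReal (Real.exp (-((N - S.card : ℕ) *
        expRate ((ν ^ 2 + 2 * δ) / (α * c + ν ^ 2))))) := by
    refine measure_biUnion_le_two_pow_mul μ fun J ⟨hJ, hrec⟩ => ?_
    rw [← hJ]
    exact measure_residualPower_le_le_exp (hJ.trans_le hS) (by positivity) (by linarith)
      (add_le_add_left (le_power_piecewise_of_not_recovers hα hc hrec) _)
  rw [avgErrProb_eq hD]
  refine (measure_mono (errorEvent_subset hD hδ hN hL)).trans ?_
  refine (measure_union_le _ _).trans (add_le_add ((measure_union_le _ _).trans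
    (add_le_add ((measure_union_le _ _).trans ?_) hhigh)) hmissed)
  rw [hrank, zero_add]
  exact hlow
lemma exists_avgErrProb_le {α ν c : ℝ} (hα : 0 < α) (hν : 0 < ν) (hc : 0 < c) :
    ∃ δ > 0, ∃ κ > 0, ∀ {N M : ℕ} {D : Decoder N M} {x : Fin M → ℂ},
      IsJointTypicalityDecoder (supp x).card ν δ D → c ≤ (supp x).card * minMod x ^ 2 →
      0 < N → 2 * (supp x).card ≤ N →
      avgErrProb α ν D x ≤
        (2 ^ M + 2) * ENNReal.ofReal (Real.exp (-((N - (supp x).card : ℕ) * κ))) := by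
  have hαc : 0 < α * c := by positivity
  have hν2 : 0 < ν ^ 2 := by positivity
  obtain ⟨δ, hδ, hδmin⟩ := exists_between (lt_min hν2 (half_pos hαc))
  obtain ⟨hδν, hδc⟩ := lt_min_iff.1 hδmin
  have hlow : 0 < expRate ((ν ^ 2 - δ) / ν ^ 2) :=
    expRate_pos (div_pos (sub_pos.2 hδν) hν2) ((div_lt_one hν2).2 (by linarith)).ne
  have hhigh : 0 < expRate ((ν ^ 2 + δ) / ν ^ 2) :=
    expRate_pos (by positivity) ((one_lt_div hν2).2 (by linarith)).ne'
  have hmissed : 0 < expRate ((ν ^ 2 + 2 * δ) / (α * c + ν ^ 2)) :=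
    expRate_pos (by positivity) ((div_lt_one (by positivity)).2 (by linarith)).ne
  obtain ⟨κ, hκ, hκmin⟩ := exists_between (lt_min hlow (lt_min hhigh hmissed))
  obtain ⟨hκlow, hκhigh, hκmissed⟩ := by simpa only [lt_min_iff] using hκmin
  refine ⟨δ, hδ, κ, hκ, fun {N M D x} hD hcx hN hL =>
    (avgErrProb_le hD hα.le hcx hδ.le hδν (by linarith) hN hL).trans ?_⟩
  rw [add_comm (2 ^ M), add_mul, two_mul (ENNReal.ofReal _)]
  gcongr

end

lemma two_pow_add_two_mul_exp_le {M : ℕ} (hM : 1 ≤ M) {t : ℝ} (ht : 4 * M ≤ t) :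
    (2 ^ M + 2) * ENNReal.ofReal (Real.exp (-t)) ≤ ENNReal.ofReal (Real.exp (-2 * M)) := by
  have h2 : (2 : ℝ) ≤ Real.exp 1 := by linarith [Real.add_one_le_exp 1]
  have hpow : (2 : ℝ) ^ M ≤ Real.exp M := by
    rw [← mul_one (M : ℝ), Real.exp_nat_mul]
    gcongr
  have htwo : (2 : ℝ) ≤ 2 ^ M := le_self_pow₀ one_le_two (by omega)
  have hcast : (2 ^ M + 2 : ℝ≥0∞) = ENNReal.ofReal (2 ^ M + 2) := by
    rw [ENNReal.ofReal_add (by positivity) (by positivity), ENNReal.ofReal_pow (by positivity)]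
    simp
  rw [hcast, ← ENNReal.ofReal_mul (by positivity)]
  refine ENNReal.ofReal_le_ofReal ?_
  calc (2 ^ M + 2) * Real.exp (-t) ≤ (Real.exp M * Real.exp M) * Real.exp (-(4 * M)) := by
        gcongr
        nlinarith
    _ = Real.exp (-2 * M) := by
        rw [← Real.exp_add, ← Real.exp_add]
        ring_nf

lemma le_two_mul_sparsity {β : ℝ} (hβ : 0 < β) {M : ℕ} (hM : 2 * β ≤ M) :
    (M : ℝ) ≤ 2 * β * sparsity β M := by
  have hfloor : M < (sparsity β M + 1) * β := by
    rw [← div_lt_iff₀ hβ, ← one_div_mul_eq_div]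
    exact Nat.lt_floor_add_one _
  linarith

lemma excess_of_lt_mul_sparsity {β κ : ℝ} (hβ : 0 < β) (hκ : 0 < κ) {N M : ℕ}
    (hM : 2 * β ≤ M) (hN : (2 + 8 * β / κ) * sparsity β M < N) :
    2 * sparsity β M ≤ N ∧ 4 * M ≤ (N - sparsity β M : ℕ) * κ := by
  have hS := le_two_mul_sparsity hβ hM
  set L := sparsity β M
  have hL : (0 : ℝ) ≤ 8 * β / κ * L := by positivity
  have h2L : 2 * L ≤ N := by
    have : (2 * L : ℝ) ≤ N := by linarith
    exact_mod_cast this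
  refine ⟨h2L, ?_⟩
  rw [Nat.cast_sub (by omega)]
  calc (4 * M : ℝ) ≤ 4 * (2 * β * L) := by gcongr
    _ = 8 * β / κ * L * κ := by field_simp; ring
    _ ≤ (N - L) * κ := by
      gcongr
      linarith [(Nat.cast_nonneg L : (0 : ℝ) ≤ L)]

lemma tendsto_exp_neg_mul_natCast {a : ℝ} (ha : 0 < a) :
    Tendsto (fun M : ℕ => Real.exp (-a * M)) atTop (𝓝 0) :=
  Real.tendsto_exp_atBot.comp
    (tendsto_natCast_atTop_atTop.const_mul_atTop_of_neg (neg_neg_of_pos ha))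

lemma eventually_exp_div_le {ξ : ℝ} (hξ : 0 < ξ) :
    ∀ᶠ M : ℕ in atTop, ENNReal.ofReal (Real.exp (-2 * M)) / ENNReal.ofReal ξ ≤
      ENNReal.ofReal (Real.exp (-1 * M)) := by
  filter_upwards [(tendsto_exp_neg_mul_natCast one_pos).eventually_le_const hξ] with M hM
  rw [← ENNReal.ofReal_div_of_pos hξ]
  refine ENNReal.ofReal_le_ofReal ((div_le_iff₀ hξ).2 ?_)
  calc Real.exp (-2 * M) = Real.exp (-1 * M) * Real.exp (-1 * M) := by
        rw [← Real.exp_add]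
        ring_nf
    _ ≤ Real.exp (-1 * M) * ξ := by gcongr

lemma exists_avgErrProb_le_exp {α β ν c : ℝ} (hα : 0 < α) (hβ : 0 < β) (hν : 0 < ν)
    (hc : 0 < c) :
    ∃ C₃ > 1, ∃ δ > 0, ∀ᶠ M : ℕ in atTop, ∀ {N : ℕ} {D : Decoder N M} {x : Fin M → ℂ},
      C₃ * (sparsity β M : ℝ) < N → IsJointTypicalityDecoder (sparsity β M) ν δ D →
      (supp x).card = sparsity β M → c ≤ sparsity β M * minMod x ^ 2 →
      avgErrProb α ν D x ≤ ENNReal.ofReal (Real.exp (-2 * M)) := by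
  obtain ⟨δ, hδ, κ, hκ, hbound⟩ := exists_avgErrProb_le hα hν hc
  have hC : 1 < 2 + 8 * β / κ := by linarith [show 0 < 8 * β / κ by positivity]
  refine ⟨2 + 8 * β / κ, hC, δ, hδ, ?_⟩
  filter_upwards [eventually_ge_atTop 1,
    tendsto_natCast_atTop_atTop.eventually_ge_atTop (2 * β)] with M hM hMβ N D x hN hD hx hmin
  obtain ⟨h2L, hexcess⟩ := excess_of_lt_mul_sparsity hβ hκ hMβ hN
  have hN0 : 0 < N := by exact_mod_cast (by positivity : (0 : ℝ) ≤ _).trans_lt hN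
  rw [← hx] at hD hmin h2L hexcess
  exact (hbound hD hmin hN0 h2L).trans (two_pow_add_two_mul_exp_le hM hexcess)

end NoisyCS

theorem theorem3_general (α β ν c : ℝ) (hα : 0 < α) (hβ : 0 < β) (hν : 0 < ν) (hc : 0 < c) :
    ∃ C₃ : ℝ, 1 < C₃ ∧ ∃ δ : ℝ, 0 < δ ∧ ∃ r : ℝ, 0 < r ∧
      ∀ N : ℕ → ℕ, (∀ᶠ M in atTop, (N M : ℝ) > C₃ * (NoisyCS.sparsity β M : ℝ)) →
        (∃ D : ∀ M, NoisyCS.Decoder (N M) M,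
          ∀ M, NoisyCS.IsJointTypicalityDecoder (NoisyCS.sparsity β M) ν δ (D M)) ∧
        ∀ D : ∀ M, NoisyCS.Decoder (N M) M,
          (∀ M, NoisyCS.IsJointTypicalityDecoder (NoisyCS.sparsity β M) ν δ (D M)) →
          ∀ x : ∀ M : ℕ, Fin M → ℂ,
            (∀ᶠ M in atTop, (NoisyCS.supp (x M)).card = NoisyCS.sparsity β M) →
            (∀ᶠ M in atTop, c ≤ (NoisyCS.sparsity β M : ℝ) * NoisyCS.minMod (x M) ^ 2) →
            Tendsto (fun M => NoisyCS.avgErrProb α ν (D M) (x M)) atTop (𝓝 0) ∧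
            (∀ᶠ M : ℕ in atTop,
              NoisyCS.avgErrProb α ν (D M) (x M) ≤ ENNReal.ofReal (Real.exp (-r * M))) ∧
            ∀ ξ ∈ Set.Ioc (0 : ℝ) 1, ∀ᶠ M : ℕ in atTop,
              NoisyCS.matrixLaw (N M) M
                  {A | NoisyCS.errProb α ν (D M) (x M) A > ENNReal.ofReal ξ} ≤
                ENNReal.ofReal (Real.exp (-r * M)) := by
  obtain ⟨C₃, hC₃, δ, hδ, hbound⟩ := NoisyCS.exists_avgErrProb_le_exp hα hβ hν hc
  refine ⟨C₃, hC₃, δ, hδ, 1, one_pos, fun N hN => ⟨?_, fun D hD x hx hmin => ?_⟩⟩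
  · choose D hD using fun M =>
      NoisyCS.exists_isJointTypicalityDecoder (N M) M (NoisyCS.sparsity β M) ν δ
    exact ⟨D, hD⟩
  have hdecay : ∀ᶠ M : ℕ in atTop,
      NoisyCS.avgErrProb α ν (D M) (x M) ≤ ENNReal.ofReal (Real.exp (-2 * M)) := by
    filter_upwards [hbound, hN, hx, hmin] with M hM hNM hxM hminM
    exact hM hNM (hD M) hxM hminM
  have hlim : Tendsto (fun M : ℕ => ENNReal.ofReal (Real.exp (-2 * M))) atTop (𝓝 0) := by
    simpa using ENNReal.tendsto_ofReal (NoisyCS.tendsto_exp_neg_mul_natCast two_pos)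
  refine ⟨tendsto_of_tendsto_of_tendsto_of_le_of_le' tendsto_const_nhds hlim
    (.of_forall fun _ => zero_le) hdecay, ?_, fun ξ hξ => ?_⟩
  · filter_upwards [hdecay] with M hM
    exact hM.trans (by gcongr; norm_num)
  · filter_upwards [hdecay, NoisyCS.eventually_exp_div_le hξ.1] with M hM hMξ
    calc NoisyCS.matrixLaw (N M) M {A | NoisyCS.errProb α ν (D M) (x M) A > ENNReal.ofReal ξ}
        ≤ NoisyCS.avgErrProb α ν (D M) (x M) / ENNReal.ofReal ξ :=
          NoisyCS.measure_lt_errProb_le_div (hD M) (x M) hξ.1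
      _ ≤ ENNReal.ofReal (Real.exp (-2 * M)) / ENNReal.ofReal ξ := by gcongr
      _ ≤ ENNReal.ofReal (Real.exp (-1 * M)) := hMξ

theorem theorem3 (α β ν c : ℝ) (hα : α ∈ Set.Ioo (0 : ℝ) 1) (hβ : 2 < β) (hν : 0 < ν)
    (hc : 0 < c) :
    ∃ C₃ : ℝ, 1 < C₃ ∧ ∃ δ : ℝ, 0 < δ ∧ ∃ r : ℝ, 0 < r ∧
      ∀ N : ℕ → ℕ, (∀ᶠ M in atTop, (N M : ℝ) > C₃ * (NoisyCS.sparsity β M : ℝ)) →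
        (∃ D : ∀ M, NoisyCS.Decoder (N M) M,
          ∀ M, NoisyCS.IsJointTypicalityDecoder (NoisyCS.sparsity β M) ν δ (D M)) ∧
        ∀ D : ∀ M, NoisyCS.Decoder (N M) M,
          (∀ M, NoisyCS.IsJointTypicalityDecoder (NoisyCS.sparsity β M) ν δ (D M)) →
          ∀ (P : ℝ) (x : ∀ M : ℕ, Fin M → ℂ),
            (∀ M, (NoisyCS.supp (x M)).card = NoisyCS.sparsity β M) →
            (∀ᶠ M in atTop, (NoisyCS.sparsity β M : ℝ) * NoisyCS.minMod (x M) ^ 2 = c) →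
            (∀ᶠ M in atTop, NoisyCS.power (x M) = P) →
            Tendsto (fun M => NoisyCS.avgErrProb α ν (D M) (x M)) atTop (𝓝 0) ∧
            (∀ᶠ M : ℕ in atTop,
              NoisyCS.avgErrProb α ν (D M) (x M) ≤ ENNReal.ofReal (Real.exp (-r * M))) ∧
            ∀ ξ ∈ Set.Ioc (0 : ℝ) 1, ∀ᶠ M : ℕ in atTop,
              NoisyCS.matrixLaw (N M) M
                  {A | NoisyCS.errProb α ν (D M) (x M) A > ENNReal.ofReal ξ} ≤
                ENNReal.ofReal (Real.exp (-r * M)) := by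
  obtain ⟨C₃, hC₃, δ, hδ, r, hr, h⟩ := theorem3_general α β ν c hα.1 (by linarith) hν hc
  exact ⟨C₃, hC₃, δ, hδ, r, hr, fun N hN => ⟨(h N hN).1, fun D hD _ x hx hmin _ =>
    (h N hN).2 D hD x (.of_forall hx) (hmin.mono fun _ h => h.ge)⟩⟩
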